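/- **Theorem 2.6.** Let $(X_t)_{t\in\mathbb Z^+}$, $\mathbb Z^+=\{0,1,2,\dots\}$, be a real-valued stochastic process on a probability space, adapted to a filtration $(\mathcal F_t)_{t\in\mathbb Z^+}$, with $X_0=0$. Write $\Delta_t := X_{t+1}-X_t$, and for real $u$ write $u^+:=\max(u,0)$ and $u^-:=\max(-u,0)$. Let $\alpha\in(0,1)$ and $\beta>\alpha$. Suppose that there exist $c>0$, $C<\infty$ and $x_0<\infty$ such that, for all $t\in\mathbb Z^+$, $$\mathbb E\big[(\Delta_t^-)^\beta \mid \mathcal F_t\big]\le C\quad\text{a.s.},$$ and, for all $x\ge x_0$ and all $t\in\mathbb Z^+$, $$\mathbb E\big[\Delta_t^+\,\mathbf 1\{\Delta_t^+\le x\}\mid\mathcal F_t\big]\ge c\,x^{1-\alpha}\quad\text{a.s.}$$ For $x\in\mathbb R$ let $\tau_x:=\min\{t\in\mathbb Z^+: X_t\ge x\}$, with $\min\emptyset:=\infty$. Then, for every $x\in\mathbb R$ and every $p\in[0,\beta/\alpha)$, $\mathbb E[\tau_x^p]<\infty$. -/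

import Mathlib

open MeasureTheory ProbabilityTheory
open scoped ENNReal NNReal

/-- The increment `Δ_t := X_{t+1} - X_t` of a real-valued process in discrete time. -/
def increment {Ω : Type*} (X : ℕ → Ω → ℝ) (t : ℕ) (ω : Ω) : ℝ :=
  X (t + 1) ω - X t ω

/-- The first passage time `τ_x := min {t ∈ ℤ⁺ : X_t ≥ x}` into the half-line `[x, ∞)`,
with `min ∅ := ∞`. -/
noncomputable def firstPassageTime {Ω : Type*} (X : ℕ → Ω → ℝ) (x : ℝ) (ω : Ω) : ℕ∞ :=
  hittingAfter X (Set.Ici x) 0 ω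

/-! A Lyapunov argument. Fix `q > 1` with `p ≤ q < β / α`, put `γ = α * q ≤ β`, and let `z = y - X
t` with `y` far above `x`. Before passage `z` is large. Upward jumps truncated near `z` lower `z ^
γ` by order `z ^ (γ - α)` in conditional mean, while downward jumps raise it by at most order `z ^
max (γ - 1) 0`. This is smaller because `α < 1` and `α < γ` (`posPart_sub_rpow_add_le`,
`exists_threshold_drift`).

Convexity (`add_rpow_le_of_rpow`) transfers this drift to `(z ^ α + e * t) ^ q`: for `e = ε / q` the
gain pays for the advance of the clock, so integrals of this function do not increase before passage
(`setLIntegral_lyapunov_succ_le`). At passage it is at least `(e * τ) ^ q`, which bounds the `q`-th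
moment of `min τ t` uniformly in `t`; monotone convergence finishes. -/

/-! ### Power inequalities and the drift of `z ^ γ`. -/

theorem rpow_le_rpow_add_tangent {q x y : ℝ} (hq : 1 ≤ q) (hx : 0 ≤ x) (hy : 0 < y) :
    y ^ q ≤ x ^ q + q * (y - x) * y ^ (q - 1) := by
  have h := one_add_mul_self_le_rpow_one_add (s := x / y - 1)
    (by linarith [div_nonneg hx hy.le]) hq
  rw [add_sub_cancel, Real.div_rpow hx hy.le, le_div_iff₀ (Real.rpow_pos_of_pos hy q)] at h
  have e : y ^ q = y * y ^ (q - 1) := by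
    rw [← Real.rpow_one_add' hy.le (by linarith)]; congr 1; ring
  have e2 : (1 + q * (x / y - 1)) * y ^ q = y ^ q - q * (y - x) * y ^ (q - 1) := by
    rw [e]; field_simp; ring
  linarith

/-- Jensen for `u ↦ u ^ q` at the points `b / a` and `1` with weights `a / (a + s)` and `s / (a +
s)`. The bound is affine in `b ^ q` and an equality at `b = a`, so a drift of `b ^ q` becomes one of
`(b + s) ^ q`. -/
theorem add_rpow_le_of_rpow {q a b s : ℝ} (hq : 1 ≤ q) (ha : 0 < a) (hb : 0 ≤ b) (hs : 0 ≤ s) :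
    (b + s) ^ q ≤ (a + s) ^ (q - 1) * (s + a ^ (1 - q) * b ^ q) := by
  have has : 0 < a + s := by linarith
  have h := (convexOn_rpow hq).2 (Set.mem_Ici.2 (show 0 ≤ b / a by positivity))
    (Set.mem_Ici.2 zero_le_one) (show 0 ≤ a / (a + s) by positivity)
    (show 0 ≤ s / (a + s) by positivity) (by field_simp)
  simp only [smul_eq_mul, Real.one_rpow, mul_one] at h
  have e : a / (a + s) * (b / a) + s / (a + s) = (b + s) / (a + s) := by field_simp
  rw [e, Real.div_rpow (by positivity) has.le, div_le_iff₀ (by positivity),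
    Real.div_rpow hb ha.le] at h
  refine h.trans (le_of_eq ?_)
  have e1 : (a + s) ^ q = (a + s) * (a + s) ^ (q - 1) := by
    rw [← Real.rpow_one_add' has.le (by linarith)]; congr 1; ring
  have e2 : a ^ (1 - q) = a / a ^ q := by rw [Real.rpow_sub ha, Real.rpow_one]
  rw [e1, e2]; field_simp; ring

theorem rpow_le_one_add_rpow {u γ β : ℝ} (hu : 0 ≤ u) (hγ : 0 ≤ γ) (hγβ : γ ≤ β) :
    u ^ γ ≤ 1 + u ^ β := by
  rcases le_total u 1 with h | h
  · linarith [Real.rpow_le_one hu h hγ, Real.rpow_nonneg hu β]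
  · linarith [Real.rpow_le_rpow_of_exponent_le h hγβ]

theorem exists_add_rpow_le {γ β : ℝ} (hγ : 0 < γ) (hγβ : γ ≤ β) :
    ∃ K : ℝ, 0 < K ∧ ∀ z u : ℝ, 1 ≤ z → 0 ≤ u →
      (z + u) ^ γ ≤ z ^ γ + K * z ^ max (γ - 1) 0 * (1 + u ^ β) := by
  rcases le_total γ 1 with h | h
  · refine ⟨1, one_pos, fun z u hz hu => ?_⟩
    rw [max_eq_right (by linarith), Real.rpow_zero]
    linarith [Real.rpow_add_le_add_rpow (by linarith : 0 ≤ z) hu hγ.le h,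
      rpow_le_one_add_rpow hu hγ.le hγβ]
  · refine ⟨γ * 2 ^ γ, by positivity, fun z u hz hu => ?_⟩
    rw [max_eq_left (by linarith)]
    have h1 := rpow_le_rpow_add_tangent h (by linarith : 0 ≤ z) (by linarith : 0 < z + u)
    have h2 : (z + u) ^ (γ - 1) ≤ z ^ (γ - 1) * (1 + u) ^ (γ - 1) := by
      rw [← Real.mul_rpow (by linarith) (by linarith)]
      exact Real.rpow_le_rpow (by linarith) (by nlinarith) (by linarith)
    have h3 : u * (1 + u) ^ (γ - 1) ≤ (1 + u) ^ γ := by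
      have : (1 + u) ^ γ = (1 + u) * (1 + u) ^ (γ - 1) := by
        rw [← Real.rpow_one_add' (by linarith) (by linarith)]; congr 1; ring
      rw [this]
      have := Real.rpow_nonneg (by linarith : 0 ≤ 1 + u) (γ - 1)
      nlinarith
    have h4 : (1 + u) ^ γ ≤ 2 ^ γ * (1 + u ^ β) := by
      rcases le_total u 1 with hu1 | hu1
      · have : (1 + u) ^ γ ≤ 2 ^ γ := Real.rpow_le_rpow (by linarith) (by linarith) hγ.le
        nlinarith [Real.rpow_nonneg hu β, Real.rpow_nonneg (zero_le_two : (0 : ℝ) ≤ 2) γ]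
      · have : (1 + u) ^ γ ≤ (2 * u) ^ γ := Real.rpow_le_rpow (by linarith) (by linarith) hγ.le
        rw [Real.mul_rpow zero_le_two hu] at this
        refine this.trans (mul_le_mul_of_nonneg_left (rpow_le_one_add_rpow hu hγ.le hγβ) ?_)
        positivity
    have hz0 : 0 ≤ z ^ (γ - 1) := Real.rpow_nonneg (by linarith) _
    calc (z + u) ^ γ ≤ z ^ γ + γ * (z + u - z) * (z + u) ^ (γ - 1) := h1
      _ = z ^ γ + γ * u * (z + u) ^ (γ - 1) := by ring
      _ ≤ z ^ γ + γ * u * (z ^ (γ - 1) * (1 + u) ^ (γ - 1)) := by gcongr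
      _ = z ^ γ + γ * z ^ (γ - 1) * (u * (1 + u) ^ (γ - 1)) := by ring
      _ ≤ z ^ γ + γ * z ^ (γ - 1) * (2 ^ γ * (1 + u ^ β)) := by
        have := h3.trans h4
        gcongr _ + _ * ?_
      _ = _ := by ring

theorem sub_rpow_add_le {γ z d : ℝ} (hγ : 0 < γ) (hz : 0 < z) (hd : 0 ≤ d) (hdz : d ≤ z) :
    (z - d) ^ γ + min γ 1 * z ^ (γ - 1) * d ≤ z ^ γ := by
  have e : z ^ γ = z * z ^ (γ - 1) := by
    rw [← Real.rpow_one_add' hz.le (by linarith)]; congr 1; ring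
  have hz0 : 0 ≤ z ^ (γ - 1) := Real.rpow_nonneg hz.le _
  rcases le_total γ 1 with h | h
  · rw [min_eq_left h]
    have h1 := rpow_one_add_le_one_add_mul_self (s := -(d / z)) (by
      rw [neg_le_neg_iff, div_le_one hz]; exact hdz) hγ.le h
    have e1 : 1 + -(d / z) = (z - d) / z := by field_simp; ring
    rw [e1, Real.div_rpow (by linarith) hz.le, div_le_iff₀ (by positivity)] at h1
    have e2 : (1 + γ * -(d / z)) * z ^ γ = z ^ γ - γ * z ^ (γ - 1) * d := by
      rw [e]; field_simp; ring
    linarith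
  · rw [min_eq_right h]
    rcases (sub_nonneg.2 hdz).eq_or_lt with h0 | h0
    · rw [← h0, Real.zero_rpow hγ.ne', e]
      nlinarith
    · have e3 : (z - d) ^ γ = (z - d) * (z - d) ^ (γ - 1) := by
        rw [← Real.rpow_one_add' h0.le (by linarith)]; congr 1; ring
      have : (z - d) ^ (γ - 1) ≤ z ^ (γ - 1) := Real.rpow_le_rpow h0.le (by linarith) (by linarith)
      rw [e3, e]
      nlinarith

/-- An upward jump beyond the truncation level `n` needs no estimate, since it cannot increase the
left-hand power; one below `n ≤ z` keeps `z - d` nonnegative, where `sub_rpow_add_le` applies. -/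
theorem posPart_sub_rpow_add_le {γ β K z d n : ℝ} (hγ : 0 < γ) (hK : 0 < K)
    (h : ∀ u : ℝ, 0 ≤ u → (z + u) ^ γ ≤ z ^ γ + K * z ^ max (γ - 1) 0 * (1 + u ^ β))
    (hz : 1 ≤ z) (hnz : n ≤ z) :
    max (z - d) 0 ^ γ + min γ 1 * z ^ (γ - 1) * (if d⁺ ≤ n then d⁺ else 0) ≤
      z ^ γ + K * z ^ max (γ - 1) 0 * (1 + d⁻ ^ β) := by
  rcases le_total 0 d with hd | hd
  · rw [posPart_eq_self.2 hd, negPart_eq_zero.2 hd]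
    have h0 : 0 ≤ K * z ^ max (γ - 1) 0 * (1 + 0 ^ β) := by
      have := Real.rpow_nonneg (le_refl (0 : ℝ)) β
      have := Real.rpow_nonneg (by linarith : 0 ≤ z) (max (γ - 1) 0)
      positivity
    split_ifs with hdn
    · rw [max_eq_left (by linarith)]
      linarith [sub_rpow_add_le hγ (by linarith : 0 < z) hd (hdn.trans hnz)]
    · have : max (z - d) 0 ^ γ ≤ z ^ γ :=
        Real.rpow_le_rpow (le_max_right _ _) (max_le (by linarith) (by linarith)) hγ.le
      linarith
  · rw [posPart_eq_zero.2 hd, negPart_eq_neg.2 hd, ite_self, mul_zero, add_zero,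
      max_eq_left (by linarith), sub_eq_add_neg]
    exact h _ (by linarith)

theorem exists_threshold_drift {α γ c C K x₀ : ℝ} (hα : α ∈ Set.Ioo (0 : ℝ) 1) (hγ : α < γ)
    (hc : 0 < c) :
    ∃ ε A : ℝ, 0 < ε ∧ 1 ≤ A ∧ ∀ z : ℝ, A ≤ z → x₀ ≤ (⌊z⌋₊ : ℝ) ∧
      K * z ^ max (γ - 1) 0 * (1 + C) + ε * z ^ (γ - α) ≤
        min γ 1 * z ^ (γ - 1) * (c * (⌊z⌋₊ : ℝ) ^ (1 - α)) := by
  have hγ0 : 0 < γ := hα.1.trans hγ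
  -- The factor `(1 / 2) ^ (1 - α)` comes from `⌊z⌋₊ ≥ z / 2` for `z ≥ 2`. The final halving leaves
  -- half of the gain to absorb the downward jumps.
  set ε : ℝ := min γ 1 * c * (1 / 2) ^ (1 - α) / 2 with hε
  have hεpos : 0 < ε := by positivity
  set κ := max (γ - 1) 0 with hκ
  have hδ : 0 < γ - α - κ := by
    have : κ < γ - α := max_lt (by linarith [hα.2]) (by linarith)
    linarith
  obtain ⟨A, hA⟩ := Filter.eventually_atTop.1
    ((tendsto_rpow_atTop hδ).eventually_ge_atTop (K * (1 + C) / ε))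
  refine ⟨ε, max (max A 2) (x₀ + 1), hεpos, ?_, fun z hz => ?_⟩
  · exact one_le_two.trans ((le_max_right A 2).trans (le_max_left _ _))
  have hzA : A ≤ z := (le_max_left _ _).trans ((le_max_left _ _).trans hz)
  have hz2 : 2 ≤ z := (le_max_right _ _).trans ((le_max_left _ _).trans hz)
  have hzx : x₀ + 1 ≤ z := (le_max_right _ _).trans hz
  have hfl := Nat.lt_floor_add_one z
  have hz0 : 0 < z := by linarith
  refine ⟨by linarith, ?_⟩
  have h1 : K * (1 + C) ≤ z ^ (γ - α - κ) * ε := (div_le_iff₀ hεpos).1 (hA z hzA)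
  have h2 : K * z ^ κ * (1 + C) ≤ ε * z ^ (γ - α) := by
    have : z ^ (γ - α) = z ^ (γ - α - κ) * z ^ κ := by
      rw [← Real.rpow_add hz0]; congr 1; ring
    rw [this]
    nlinarith [Real.rpow_pos_of_pos hz0 κ]
  have h3 : (1 / 2) ^ (1 - α) * z ^ (1 - α) ≤ (⌊z⌋₊ : ℝ) ^ (1 - α) := by
    rw [← Real.mul_rpow (by norm_num) hz0.le]
    exact Real.rpow_le_rpow (by linarith) (by linarith) (by linarith [hα.2])
  have h4 : z ^ (γ - α) = z ^ (γ - 1) * z ^ (1 - α) := by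
    rw [← Real.rpow_add hz0]; congr 1; ring
  calc K * z ^ κ * (1 + C) + ε * z ^ (γ - α) ≤ ε * z ^ (γ - α) + ε * z ^ (γ - α) := by gcongr
    _ = min γ 1 * z ^ (γ - 1) * (c * ((1 / 2) ^ (1 - α) * z ^ (1 - α))) := by
      rw [h4, hε]; ring
    _ ≤ _ := by gcongr

/-! ### Conditional drift as an inequality of integrals. -/

section CondLExp

variable {Ω : Type*} {m₀ m : MeasurableSpace Ω} {μ : Measure[m₀] Ω}

/-- The measures with densities `Y` and `μ⁻[Y | m]` agree on `m`, hence integrate `m`-measurable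
functions alike. -/
theorem setLIntegral_mul_condLExp (hm : m ≤ m₀) [SigmaFinite (μ.trim hm)] {A Y : Ω → ℝ≥0∞}
    (hA : Measurable[m] A) (hY : Measurable[m₀] Y) {G : Set Ω} (hG : MeasurableSet[m] G) :
    ∫⁻ ω in G, A ω * μ⁻[Y | m] ω ∂μ = ∫⁻ ω in G, A ω * Y ω ∂μ := by
  have key : (μ.withDensity μ⁻[Y | m]).trim hm = (μ.withDensity Y).trim hm := by
    refine @Measure.ext _ m _ _ fun s hs => ?_
    rw [trim_measurableSet_eq hm hs, trim_measurableSet_eq hm hs, withDensity_apply _ (hm s hs),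
      withDensity_apply _ (hm s hs), setLIntegral_condLExp hm _ _ hs]
  have hGA : Measurable[m] (G.indicator A) := hA.indicator hG
  have h (W : Ω → ℝ≥0∞) (hW : Measurable[m₀] W) :
      ∫⁻ ω in G, A ω * W ω ∂μ = ∫⁻ ω, G.indicator A ω ∂((μ.withDensity W).trim hm) := by
    rw [lintegral_trim hm hGA,
      lintegral_withDensity_eq_lintegral_mul _ hW (hGA.mono hm le_rfl),
      ← lintegral_indicator (hm G hG)]
    refine lintegral_congr fun ω => ?_
    by_cases hω : ω ∈ G <;> simp [hω, mul_comm]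
  rw [h _ (measurable_condLExp' _ _ _), h _ hY, key]

theorem setLIntegral_le_of_condLExp_drift [IsFiniteMeasure μ] (hm : m ≤ m₀)
    {V v u D D' H H₀ : Ω → ℝ≥0∞} {r C M : ℝ≥0∞} {G : Set Ω} (hG : MeasurableSet[m] G)
    (hv : Measurable[m₀] v) (hu : Measurable[m₀] u) (hD : Measurable[m] D)
    (hD' : Measurable[m] D') (hH : Measurable[m] H) (hM : M ≠ ∞)
    (hstep : ∀ ω ∈ G, V ω + D ω * v ω ≤ H ω + D' ω * u ω)
    (hvr : ∀ᵐ ω ∂μ, r ≤ μ⁻[v | m] ω) (huC : ∀ᵐ ω ∂μ, μ⁻[u | m] ω ≤ C)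
    (hdrift : ∀ ω ∈ G, H ω + D' ω * C ≤ H₀ ω + D ω * r) (hbdd : ∀ ω ∈ G, D ω * r ≤ M) :
    ∫⁻ ω in G, V ω ∂μ ≤ ∫⁻ ω in G, H₀ ω ∂μ := by
  have hG₀ := hm G hG
  have hD₀ : Measurable[m₀] D := hD.mono hm le_rfl
  have hH₀ : Measurable[m₀] H := hH.mono hm le_rfl
  -- The gain is added to both sides and cancelled at the end, which in `ℝ≥0∞` requires it to be
  -- finite.
  have hfin : ∫⁻ ω in G, D ω * r ∂μ ≠ ∞ := by
    refine ne_top_of_le_ne_top ?_ (setLIntegral_mono' hG₀ hbdd)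
    rw [setLIntegral_const]
    exact ENNReal.mul_ne_top hM (measure_ne_top _ _)
  refine ENNReal.le_of_add_le_add_right hfin ?_
  calc ∫⁻ ω in G, V ω ∂μ + ∫⁻ ω in G, D ω * r ∂μ
      ≤ ∫⁻ ω in G, V ω ∂μ + ∫⁻ ω in G, D ω * μ⁻[v | m] ω ∂μ := by
        gcongr 1
        refine lintegral_mono_ae (ae_restrict_of_ae ?_)
        filter_upwards [hvr] with ω hω
        gcongr
    _ = ∫⁻ ω in G, V ω + D ω * v ω ∂μ := by
        rw [setLIntegral_mul_condLExp hm hD hv hG, ← lintegral_add_right _ (by fun_prop)]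
    _ ≤ ∫⁻ ω in G, H ω + D' ω * u ω ∂μ := setLIntegral_mono' hG₀ hstep
    _ = ∫⁻ ω in G, H ω + D' ω * μ⁻[u | m] ω ∂μ := by
        rw [lintegral_add_left hH₀, lintegral_add_left hH₀, setLIntegral_mul_condLExp hm hD' hu hG]
    _ ≤ ∫⁻ ω in G, H ω + D' ω * C ∂μ := by
        refine lintegral_mono_ae (ae_restrict_of_ae ?_)
        filter_upwards [huC] with ω hω
        gcongr
    _ ≤ ∫⁻ ω in G, H₀ ω + D ω * r ∂μ := setLIntegral_mono' hG₀ hdrift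
    _ = _ := lintegral_add_right _ (hD₀.mul_const r)

end CondLExp

/-! ### Countable decomposition and monotone convergence. -/

section Lebesgue

variable {Ω : Type*} {m : MeasurableSpace Ω} {μ : Measure Ω}

theorem setLIntegral_mono_of_fibers {ι : Type*} [Countable ι] [MeasurableSpace ι]
    [MeasurableSingletonClass ι] {N : Ω → ι} (hN : Measurable N) {f g : Ω → ℝ≥0∞} {G : Set Ω}
    (hG : MeasurableSet G)
    (h : ∀ k, ∫⁻ ω in G ∩ N ⁻¹' {k}, f ω ∂μ ≤ ∫⁻ ω in G ∩ N ⁻¹' {k}, g ω ∂μ) :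
    ∫⁻ ω in G, f ω ∂μ ≤ ∫⁻ ω in G, g ω ∂μ := by
  have hU : G = ⋃ k, G ∩ N ⁻¹' {k} := by ext ω; simp
  have hmeas (k : ι) : MeasurableSet (G ∩ N ⁻¹' {k}) := hG.inter (hN (measurableSet_singleton k))
  have hdisj : Pairwise (Function.onFun Disjoint fun k => G ∩ N ⁻¹' {k}) := by
    intro i j hij
    refine Set.disjoint_left.2 fun ω hi hj => hij ?_
    exact hi.2.symm.trans hj.2
  rw [hU, lintegral_iUnion hmeas hdisj, lintegral_iUnion hmeas hdisj]
  exact ENNReal.tsum_le_tsum h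

theorem lintegral_rpow_le_of_forall_min {τ : Ω → ℕ∞} (hτ : Measurable τ) {q : ℝ} (hq : 0 ≤ q)
    {B : ℝ≥0∞} (h : ∀ t : ℕ, ∫⁻ ω, ((min (τ ω) t : ℕ∞) : ℝ≥0∞) ^ q ∂μ ≤ B) :
    ∫⁻ ω, (τ ω : ℝ≥0∞) ^ q ∂μ ≤ B := by
  have hsup (k : ℕ∞) : (k : ℝ≥0∞) ^ q ≤ ⨆ t : ℕ, ((min k t : ℕ∞) : ℝ≥0∞) ^ q := by
    induction k using ENat.recTopCoe with
    | coe n => exact le_iSup_of_le n (by simp)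
    | top =>
      rcases hq.eq_or_lt with rfl | hq'
      · simp
      · refine le_of_eq (Eq.symm ?_)
        simp only [le_top, inf_of_le_right, ENat.toENNReal_coe, ENat.toENNReal_top,
          ENNReal.top_rpow_of_pos hq']
        refine iSup_eq_top.2 fun b hb => ?_
        obtain ⟨n, hn⟩ := ENNReal.exists_nat_gt
          (ENNReal.rpow_ne_top_of_nonneg (inv_nonneg.2 hq) hb.ne : b ^ q⁻¹ ≠ ∞)
        exact ⟨n, (ENNReal.rpow_inv_lt_iff hq').1 hn⟩
  calc ∫⁻ ω, (τ ω : ℝ≥0∞) ^ q ∂μ ≤ ∫⁻ ω, ⨆ t : ℕ, ((min (τ ω) t : ℕ∞) : ℝ≥0∞) ^ q ∂μ :=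
        lintegral_mono fun ω => hsup _
    _ = ⨆ t : ℕ, ∫⁻ ω, ((min (τ ω) t : ℕ∞) : ℝ≥0∞) ^ q ∂μ := by
        refine lintegral_iSup (fun t => ?_) fun s t hst ω => ?_
        · exact (Measurable.of_discrete (f := fun k : ℕ∞ => ((min k t : ℕ∞) : ℝ≥0∞) ^ q)).comp hτ
        · dsimp only
          gcongr
    _ ≤ B := iSup_le h

end Lebesgue

/-! ### One-step estimates for `(z ^ α + s) ^ q`. -/

section OneStep

variable {α β q K z d n s : ℝ}

theorem lyapunov_step (hα : 0 < α) (hq : 1 ≤ q) (hK : 0 < K)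
    (h : ∀ u : ℝ, 0 ≤ u →
      (z + u) ^ (α * q) ≤ z ^ (α * q) + K * z ^ max (α * q - 1) 0 * (1 + u ^ β))
    (hz : 1 ≤ z) (hnz : n ≤ z) (hs : 0 ≤ s) :
    (max (z - d) 0 ^ α + s) ^ q +
        (z ^ α + s) ^ (q - 1) * z ^ (α - α * q) * (min (α * q) 1 * z ^ (α * q - 1)) *
          (if d⁺ ≤ n then d⁺ else 0) ≤
      ((z ^ α + s) ^ q +
          (z ^ α + s) ^ (q - 1) * z ^ (α - α * q) * (K * z ^ max (α * q - 1) 0)) +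
        (z ^ α + s) ^ (q - 1) * z ^ (α - α * q) * (K * z ^ max (α * q - 1) 0) * d⁻ ^ β := by
  have hz0 : 0 < z := by linarith
  have hγ : 0 < α * q := by positivity
  have hzα : 0 < z ^ α := Real.rpow_pos_of_pos hz0 α
  have hm : 0 ≤ max (z - d) 0 := le_max_right _ _
  have h1 := add_rpow_le_of_rpow hq hzα (Real.rpow_nonneg hm α) hs
  rw [← Real.rpow_mul hm, ← Real.rpow_mul hz0.le,
    show α * (1 - q) = α - α * q by ring] at h1
  have h2 := posPart_sub_rpow_add_le (d := d) (n := n) hγ hK h hz hnz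
  have h3 : (z ^ α + s) ^ q = (z ^ α + s) ^ (q - 1) * (z ^ α + s) := by
    rw [mul_comm, ← Real.rpow_one_add' (by linarith) (by linarith)]; congr 1; ring
  have h4 : z ^ (α - α * q) * z ^ (α * q) = z ^ α := by
    rw [← Real.rpow_add hz0]; congr 1; ring
  have hP : 0 ≤ (z ^ α + s) ^ (q - 1) := Real.rpow_nonneg (by linarith) _
  have hE : 0 ≤ z ^ (α - α * q) := Real.rpow_nonneg hz0.le _
  have h5 := mul_le_mul_of_nonneg_left h2 (mul_nonneg hP hE)
  rw [h3]
  have h6 : (z ^ α + s) ^ (q - 1) * z ^ (α - α * q) * z ^ (α * q) =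
      (z ^ α + s) ^ (q - 1) * z ^ α := by rw [mul_assoc, h4]
  linarith

/-- The tangent is taken at the advanced clock `s + ε / q`, so the cost `ε * (z ^ α + (s + ε / q)) ^
(q - 1)` has the same prefactor as the spatial gain and is covered by it. -/
theorem lyapunov_drift {c C ε r : ℝ} (hq : 1 ≤ q) (hz : 0 < z) (hs : 0 ≤ s) (hε : 0 < ε)
    (h : K * z ^ max (α * q - 1) 0 * (1 + C) + ε * z ^ (α * q - α) ≤
      min (α * q) 1 * z ^ (α * q - 1) * (c * r)) :
    (z ^ α + (s + ε / q)) ^ q +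
          (z ^ α + (s + ε / q)) ^ (q - 1) * z ^ (α - α * q) * (K * z ^ max (α * q - 1) 0) +
        (z ^ α + (s + ε / q)) ^ (q - 1) * z ^ (α - α * q) * (K * z ^ max (α * q - 1) 0) * C ≤
      (z ^ α + s) ^ q +
        (z ^ α + (s + ε / q)) ^ (q - 1) * z ^ (α - α * q) *
          (min (α * q) 1 * z ^ (α * q - 1)) * (c * r) := by
  have hq0 : 0 < q := by linarith
  have hzα : 0 < z ^ α := Real.rpow_pos_of_pos hz α
  have hεq : 0 < ε / q := by positivity
  have h1 := rpow_le_rpow_add_tangent (x := z ^ α + s) (y := z ^ α + (s + ε / q)) hq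
    (by positivity) (by positivity)
  have e1 : q * (z ^ α + (s + ε / q) - (z ^ α + s)) = ε := by field_simp; ring
  rw [e1] at h1
  have h4 : z ^ (α - α * q) * z ^ (α * q - α) = 1 := by
    rw [← Real.rpow_add hz]; simp
  have hD : 0 ≤ (z ^ α + (s + ε / q)) ^ (q - 1) * z ^ (α - α * q) := by positivity
  have h5 := mul_le_mul_of_nonneg_left h hD
  have h6 : (z ^ α + (s + ε / q)) ^ (q - 1) * z ^ (α - α * q) * (ε * z ^ (α * q - α)) =
      ε * (z ^ α + (s + ε / q)) ^ (q - 1) := by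
    calc _ = (z ^ α + (s + ε / q)) ^ (q - 1) * ε * (z ^ (α - α * q) * z ^ (α * q - α)) := by ring
      _ = _ := by rw [h4]; ring
  linarith

end OneStep

/-! ### The supermartingale inequality and moments of the passage time. -/

section FirstPassage

variable {Ω : Type*} {m : MeasurableSpace Ω} {μ : Measure Ω} {ℱ : Filtration ℕ m} {X : ℕ → Ω → ℝ}

theorem setLIntegral_lyapunov_succ_le [IsFiniteMeasure μ] (hX : Adapted ℱ X)
    {α β q K c ε A x₀ : ℝ} {C : ℝ≥0} (hα : 0 < α) (hq : 1 ≤ q) (hK : 0 < K) (hc : 0 < c)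
    (hε : 0 < ε) (hA : 1 ≤ A)
    (hgrow : ∀ z u : ℝ, 1 ≤ z → 0 ≤ u →
      (z + u) ^ (α * q) ≤ z ^ (α * q) + K * z ^ max (α * q - 1) 0 * (1 + u ^ β))
    (hthr : ∀ z : ℝ, A ≤ z → x₀ ≤ (⌊z⌋₊ : ℝ) ∧
      K * z ^ max (α * q - 1) 0 * (1 + C) + ε * z ^ (α * q - α) ≤
        min (α * q) 1 * z ^ (α * q - 1) * (c * (⌊z⌋₊ : ℝ) ^ (1 - α)))
    {t : ℕ}
    (hneg : ∀ᵐ ω ∂μ, μ⁻[fun ω' => ENNReal.ofReal ((increment X t ω')⁻ ^ β) | ℱ t] ω ≤ C)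
    (hpos : ∀ x : ℝ, x₀ ≤ x → ∀ᵐ ω ∂μ, ENNReal.ofReal (c * x ^ (1 - α)) ≤
        μ⁻[Set.indicator {ω' | (increment X t ω')⁺ ≤ x}
          (fun ω' => ENNReal.ofReal ((increment X t ω')⁺)) | ℱ t] ω)
    {s y : ℝ} (hs : 0 ≤ s) {G : Set Ω} (hG : MeasurableSet[ℱ t] G)
    (hGA : ∀ ω ∈ G, A ≤ y - X t ω) :
    ∫⁻ ω in G, ENNReal.ofReal ((max (y - X (t + 1) ω) 0 ^ α + (s + ε / q)) ^ q) ∂μ ≤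
      ∫⁻ ω in G, ENNReal.ofReal ((max (y - X t ω) 0 ^ α + s) ^ q) ∂μ := by
  have hm : ℱ t ≤ m := ℱ.le t
  have hq0 : 0 < q := by linarith
  have hεq : 0 < ε / q := by positivity
  have hinc : Measurable (increment X t) :=
    ((hX (t + 1)).mono (ℱ.le _) le_rfl).sub ((hX t).mono hm le_rfl)
  have hincp : Measurable fun ω => (increment X t ω)⁺ := hinc.sup_const 0
  have hincn : Measurable fun ω => (increment X t ω)⁻ := hinc.neg.sup_const 0
  set P : ℝ → ℝ := fun z => (z ^ α + (s + ε / q)) ^ (q - 1) * z ^ (α - α * q) with hP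
  set D : ℝ → ℝ := fun z => P z * (min (α * q) 1 * z ^ (α * q - 1)) with hD
  set D' : ℝ → ℝ := fun z => P z * (K * z ^ max (α * q - 1) 0) with hD'
  set H : ℝ → ℝ := fun z => (z ^ α + (s + ε / q)) ^ q + D' z with hH
  have hPm : Measurable P := by fun_prop
  have hDm : Measurable D := by fun_prop
  have hDm' : Measurable D' := by fun_prop
  have hHm : Measurable H := by fun_prop
  have hZ : Measurable[ℱ t] fun ω => y - X t ω := (hX t).const_sub y
  have hlift {f : ℝ → ℝ} (hf : Measurable f) :
      Measurable[ℱ t] fun ω => ENNReal.ofReal (f (y - X t ω)) := (hf.comp hZ).ennreal_ofReal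
  -- The truncated-mean hypothesis holds almost surely for each fixed level only, so the random
  -- level `⌊z⌋₊` is frozen on countably many fibers. The second coordinate bounds `D` on each
  -- fiber, which makes the cancelled gain finite.
  have hN : Measurable[ℱ t] fun ω => (⌊y - X t ω⌋₊, ⌊D (y - X t ω)⌋₊) :=
    (Nat.measurable_floor.comp hZ).prodMk (Nat.measurable_floor.comp (hDm.comp hZ))
  refine setLIntegral_mono_of_fibers (hN.mono hm le_rfl) (hm G hG) fun k => ?_
  rcases (G ∩ (fun ω => (⌊y - X t ω⌋₊, ⌊D (y - X t ω)⌋₊)) ⁻¹' {k}).eq_empty_or_nonempty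
    with hemp | ⟨ω₀, hω₀, hkω₀⟩
  · simp [hemp]
  have hk1 {ω : Ω} (hω : (⌊y - X t ω⌋₊, ⌊D (y - X t ω)⌋₊) = k) : ⌊y - X t ω⌋₊ = k.1 :=
    congrArg Prod.fst hω
  have hx₀ : x₀ ≤ (k.1 : ℝ) := by
    rw [← hk1 hkω₀]
    exact (hthr _ (hGA _ hω₀)).1
  have hr0 : 0 ≤ c * (k.1 : ℝ) ^ (1 - α) := by positivity
  refine setLIntegral_le_of_condLExp_drift hm (hG.inter (hN (measurableSet_singleton k)))
    (v := Set.indicator {ω' | (increment X t ω')⁺ ≤ k.1}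
      (fun ω' => ENNReal.ofReal ((increment X t ω')⁺)))
    (u := fun ω' => ENNReal.ofReal ((increment X t ω')⁻ ^ β))
    (D := fun ω => ENNReal.ofReal (D (y - X t ω))) (D' := fun ω => ENNReal.ofReal (D' (y - X t ω)))
    (H := fun ω => ENNReal.ofReal (H (y - X t ω)))
    (M := ENNReal.ofReal ((k.2 + 1) * (c * (k.1 : ℝ) ^ (1 - α))))
    (hincp.ennreal_ofReal.indicator (measurableSet_le hincp measurable_const))
    (hincn.pow_const β).ennreal_ofReal (hlift hDm) (hlift hDm') (hlift hHm)
    ENNReal.ofReal_ne_top ?_ (hpos _ hx₀) hneg ?_ ?_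
  all_goals
    rintro ω ⟨hω, hkω⟩
    have hzA := hGA ω hω
    have hz1 : 1 ≤ y - X t ω := hA.trans hzA
    have hz0 : 0 < y - X t ω := by linarith
    have hfl : ⌊y - X t ω⌋₊ = k.1 := hk1 hkω
    have hP0 : 0 ≤ P (y - X t ω) := by simp only [hP]; positivity
    have hD0 : 0 ≤ D (y - X t ω) := by simp only [hD]; positivity
    have hD0' : 0 ≤ D' (y - X t ω) := by simp only [hD']; positivity
    have hH0 : 0 ≤ H (y - X t ω) := by simp only [hH]; positivity
  · have hnz : (k.1 : ℝ) ≤ y - X t ω := by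
      rw [← hfl]; exact Nat.floor_le hz0.le
    have hstep := lyapunov_step (d := increment X t ω) (s := s + ε / q) hα hq hK
      (fun u hu => hgrow _ u hz1 hu) hz1 hnz (by positivity)
    have hnext : y - X t ω - increment X t ω = y - X (t + 1) ω := by
      simp only [increment]; ring
    rw [hnext] at hstep
    have hv : Set.indicator {ω' | (increment X t ω')⁺ ≤ k.1}
        (fun ω' => ENNReal.ofReal ((increment X t ω')⁺)) ω =
        ENNReal.ofReal (if (increment X t ω)⁺ ≤ k.1 then (increment X t ω)⁺ else 0) := by
      by_cases hle : (increment X t ω)⁺ ≤ k.1 <;> simp [hle]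
    have hv0 : 0 ≤ if (increment X t ω)⁺ ≤ k.1 then (increment X t ω)⁺ else 0 := by
      split_ifs <;> simp [posPart_nonneg]
    have hmax : 0 ≤ max (y - X (t + 1) ω) 0 := le_max_right _ _
    have hu0 : 0 ≤ (increment X t ω)⁻ ^ β := Real.rpow_nonneg (negPart_nonneg _) _
    rw [hv, ← ENNReal.ofReal_mul hD0, ← ENNReal.ofReal_mul hD0',
      ← ENNReal.ofReal_add (by positivity) (by positivity),
      ← ENNReal.ofReal_add hH0 (by positivity)]
    exact ENNReal.ofReal_le_ofReal hstep
  · have hdrift := lyapunov_drift (s := s) hq hz0 hs hε (hthr _ hzA).2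
    rw [hfl] at hdrift
    rw [max_eq_left hz0.le, ← ENNReal.ofReal_coe_nnreal, ← ENNReal.ofReal_mul hD0',
      ← ENNReal.ofReal_mul hD0, ← ENNReal.ofReal_add hH0 (by positivity),
      ← ENNReal.ofReal_add (by positivity) (by positivity)]
    exact ENNReal.ofReal_le_ofReal hdrift
  · rw [← ENNReal.ofReal_mul hD0]
    refine ENNReal.ofReal_le_ofReal (mul_le_mul_of_nonneg_right ?_ hr0)
    have : ⌊D (y - X t ω)⌋₊ = k.2 := congrArg Prod.snd hkω
    rw [← this]
    exact (Nat.lt_floor_add_one _).le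

theorem lt_firstPassageTime_iff {x : ℝ} {t : ℕ} {ω : Ω} :
    (t : ℕ∞) < firstPassageTime X x ω ↔ ∀ j ≤ t, X j ω < x := by
  have h : firstPassageTime X x ω ≤ (t : ℕ∞) ↔ ∃ j ∈ Set.Icc 0 t, X j ω ∈ Set.Ici x :=
    hittingAfter_le_iff
  rw [← not_le, h]
  simp

theorem measurableSet_lt_firstPassageTime (hX : Adapted ℱ X) (x : ℝ) (t : ℕ) :
    MeasurableSet[ℱ t] {ω | (t : ℕ∞) < firstPassageTime X x ω} := by
  have : {ω | (t : ℕ∞) < firstPassageTime X x ω} = ⋂ j, ⋂ _ : j ≤ t, X j ⁻¹' Set.Iio x := by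
    ext ω; simp [lt_firstPassageTime_iff]
  rw [this]
  exact MeasurableSet.iInter fun j => MeasurableSet.iInter fun hj =>
    ℱ.mono hj _ (hX j measurableSet_Iio)

theorem measurable_firstPassageTime (hX : Adapted ℱ X) (x : ℝ) :
    Measurable (firstPassageTime X x) := by
  refine measurable_to_countable' fun k => ?_
  have hG (t : ℕ) : MeasurableSet {ω | (t : ℕ∞) < firstPassageTime X x ω} :=
    ℱ.le t _ (measurableSet_lt_firstPassageTime hX x t)
  have : firstPassageTime X x ⁻¹' {k} =
      (⋂ t : ℕ, ⋂ _ : (t : ℕ∞) < k, {ω | (t : ℕ∞) < firstPassageTime X x ω}) ∩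
        ⋂ t : ℕ, ⋂ _ : k ≤ (t : ℕ∞), {ω | (t : ℕ∞) < firstPassageTime X x ω}ᶜ := by
    ext ω
    simp only [Set.mem_preimage, Set.mem_singleton_iff, Set.mem_inter_iff, Set.mem_iInter,
      Set.mem_ofPred_eq, Set.mem_compl_iff, not_lt]
    refine ⟨fun h => by subst h; exact ⟨fun _ h => h, fun _ h => h⟩, fun h => le_antisymm ?_ ?_⟩
    · rcases eq_or_ne k ⊤ with rfl | hk
      · exact le_top
      · lift k to ℕ using hk
        exact h.2 k le_rfl
    · by_contra! hlt
      obtain ⟨t, ht⟩ := ENat.ne_top_iff_exists.1 hlt.ne_top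
      rw [← ht] at hlt
      exact absurd (h.1 t hlt) (by simp [ht])
  rw [this]
  exact (MeasurableSet.iInter fun t => MeasurableSet.iInter fun _ => hG t).inter
    (MeasurableSet.iInter fun t => MeasurableSet.iInter fun _ => (hG t).compl)

theorem lintegral_firstPassageTime_rpow_lt_top_of_supermartingale [IsProbabilityMeasure μ]
    (hX : Adapted ℱ X) (hX0 : ∀ᵐ ω ∂μ, X 0 ω = 0) {α q e x y : ℝ} (hq : 0 < q) (he : 0 < e)
    (hstep : ∀ t : ℕ,
      ∫⁻ ω in {ω | (t : ℕ∞) < firstPassageTime X x ω},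
          ENNReal.ofReal ((max (y - X (t + 1) ω) 0 ^ α + (e * t + e)) ^ q) ∂μ ≤
        ∫⁻ ω in {ω | (t : ℕ∞) < firstPassageTime X x ω},
          ENNReal.ofReal ((max (y - X t ω) 0 ^ α + e * t) ^ q) ∂μ) :
    ∫⁻ ω, (firstPassageTime X x ω : ℝ≥0∞) ^ q ∂μ < ∞ := by
  classical
  set τ := firstPassageTime X x with hτ
  set V : ℕ → Ω → ℝ≥0∞ := fun t ω =>
    ENNReal.ofReal ((max (y - X t ω) 0 ^ α + e * t) ^ q) with hV
  -- From passage on, `V` is replaced by its lower bound `(e * τ) ^ q`; this ignores the overshoot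
  -- and keeps the integrals nonincreasing.
  set Y : ℕ → Ω → ℝ≥0∞ := fun t ω =>
    if (t : ℕ∞) < τ ω then V t ω else (ENNReal.ofReal e * (τ ω : ℝ≥0∞)) ^ q with hY
  have hVlow (t : ℕ) (ω : Ω) : (ENNReal.ofReal e * (t : ℝ≥0∞)) ^ q ≤ V t ω := by
    have hm : 0 ≤ max (y - X t ω) 0 ^ α := Real.rpow_nonneg (le_max_right _ _) _
    rw [← ENNReal.ofReal_natCast, ← ENNReal.ofReal_mul he.le,
      ENNReal.ofReal_rpow_of_nonneg (by positivity) hq.le]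
    refine ENNReal.ofReal_le_ofReal (Real.rpow_le_rpow (by positivity) ?_ hq.le)
    linarith
  have hmin (t : ℕ) (ω : Ω) :
      (ENNReal.ofReal e * ((min (τ ω) t : ℕ∞) : ℝ≥0∞)) ^ q ≤ Y t ω := by
    by_cases h : (t : ℕ∞) < τ ω
    · simp only [hY, h, if_true, min_eq_right h.le]
      simpa using hVlow t ω
    · simp only [hY, h, if_false, min_eq_left (not_lt.1 h), le_refl]
  have hsucc (t : ℕ) : ∫⁻ ω, Y (t + 1) ω ∂μ ≤ ∫⁻ ω, Y t ω ∂μ := by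
    have hG := ℱ.le t _ (measurableSet_lt_firstPassageTime hX x t)
    rw [← lintegral_add_compl _ hG, ← lintegral_add_compl (Y t) hG]
    refine add_le_add ?_ ?_
    · calc _ ≤ ∫⁻ ω in {ω | (t : ℕ∞) < τ ω}, V (t + 1) ω ∂μ := by
            refine setLIntegral_mono' hG fun ω hω => ?_
            by_cases h : ((t + 1 : ℕ) : ℕ∞) < τ ω
            · simp only [hY, h, if_true, le_refl]
            · have : τ ω = ((t + 1 : ℕ) : ℕ∞) :=
                le_antisymm (not_lt.1 h) (by
                  rw [Nat.cast_add, Nat.cast_one]; exact Order.add_one_le_of_lt hω)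
              simp only [hY, h, if_false]
              rw [this]
              simpa using hVlow (t + 1) ω
        _ ≤ ∫⁻ ω in {ω | (t : ℕ∞) < τ ω}, V t ω ∂μ := by
            refine le_trans (le_of_eq ?_) (hstep t)
            simp only [hV]
            push_cast
            simp only [mul_add, mul_one]
        _ = _ := by
            refine setLIntegral_congr_fun hG fun ω hω => ?_
            have hω' : (t : ℕ∞) < τ ω := hω
            simp only [hY, hω', if_true]
    · refine setLIntegral_mono' hG.compl fun ω hω => ?_
      have h1 : ¬ (t : ℕ∞) < τ ω := hω
      have h2 : ¬ ((t + 1 : ℕ) : ℕ∞) < τ ω := fun h =>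
        h1 (lt_of_le_of_lt (by exact_mod_cast t.le_succ) h)
      simp only [hY, h1, h2, if_false, le_refl]
  have hzero : ∫⁻ ω, Y 0 ω ∂μ ≤ ENNReal.ofReal ((max y 0 ^ α) ^ q) := by
    calc ∫⁻ ω, Y 0 ω ∂μ ≤ ∫⁻ _, ENNReal.ofReal ((max y 0 ^ α) ^ q) ∂μ := by
          refine lintegral_mono_ae ?_
          filter_upwards [hX0] with ω hω
          by_cases h : 0 < τ ω
          · simp [hY, hV, h, hω]
          · have h0 : τ ω = 0 := by simpa using h
            simp [hY, h0, hq]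
      _ = _ := by simp
  have hbound (t : ℕ) : ∫⁻ ω, Y t ω ∂μ ≤ ENNReal.ofReal ((max y 0 ^ α) ^ q) := by
    induction t with
    | zero => exact hzero
    | succ t ih => exact (hsucc t).trans ih
  have he0 : ENNReal.ofReal e ^ q ≠ 0 := by
    simp [he]
  have heT : ENNReal.ofReal e ^ q ≠ ∞ := ENNReal.rpow_ne_top_of_nonneg hq.le ENNReal.ofReal_ne_top
  refine lt_of_le_of_lt (lintegral_rpow_le_of_forall_min (measurable_firstPassageTime hX x) hq.le
    (B := ENNReal.ofReal ((max y 0 ^ α) ^ q) / ENNReal.ofReal e ^ q) fun t => ?_)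
    (ENNReal.div_lt_top ENNReal.ofReal_ne_top he0)
  rw [ENNReal.le_div_iff_mul_le (Or.inl he0) (Or.inl heT), mul_comm,
    ← lintegral_const_mul' _ _ heT]
  refine (lintegral_mono fun ω => ?_).trans (hbound t)
  rw [← ENNReal.mul_rpow_of_nonneg _ _ hq.le]
  exact hmin t ω

theorem lintegral_rpow_lt_top_of_le [IsFiniteMeasure μ] {f : Ω → ℝ≥0∞} {p q : ℝ} (hp : 0 ≤ p)
    (hpq : p ≤ q) (h : ∫⁻ ω, f ω ^ q ∂μ < ∞) : ∫⁻ ω, f ω ^ p ∂μ < ∞ := by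
  have hle (a : ℝ≥0∞) : a ^ p ≤ 1 + a ^ q := by
    rcases le_total a 1 with ha | ha
    · exact (ENNReal.rpow_le_one ha hp).trans le_self_add
    · exact (ENNReal.rpow_le_rpow_of_exponent_le ha hpq).trans le_add_self
  refine (lintegral_mono fun ω => hle (f ω)).trans_lt ?_
  rw [lintegral_add_left measurable_const, lintegral_const, one_mul]
  exact ENNReal.add_lt_top.2 ⟨measure_lt_top _ _, h⟩

end FirstPassage

theorem theorem2p6 {Ω : Type*} {m : MeasurableSpace Ω} (μ : Measure Ω) [IsProbabilityMeasure μ]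
    (ℱ : Filtration ℕ m) (X : ℕ → Ω → ℝ) (hX : Adapted ℱ X)
    (hX0 : ∀ᵐ ω ∂μ, X 0 ω = 0)
    (α β : ℝ) (hα : α ∈ Set.Ioo (0 : ℝ) 1) (hβ : α < β)
    (C : ℝ≥0) (c : ℝ) (hc : 0 < c) (x₀ : ℝ)
    (hneg : ∀ t : ℕ, ∀ᵐ ω ∂μ,
      μ⁻[fun ω' => ENNReal.ofReal ((increment X t ω')⁻ ^ β) | ℱ t] ω ≤ C)
    (hpos : ∀ x : ℝ, x₀ ≤ x → ∀ t : ℕ, ∀ᵐ ω ∂μ,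
      ENNReal.ofReal (c * x ^ (1 - α)) ≤
        μ⁻[Set.indicator {ω' | (increment X t ω')⁺ ≤ x}
          (fun ω' => ENNReal.ofReal ((increment X t ω')⁺)) | ℱ t] ω)
    (x : ℝ) (p : ℝ) (hp : p ∈ Set.Ico 0 (β / α)) :
    ∫⁻ ω, (firstPassageTime X x ω : ℝ≥0∞) ^ p ∂μ < ∞ := by
  have hα0 : 0 < α := hα.1
  -- `q > 1` is needed even for small `p`, to have `α < α * q`; `q < β / α` keeps `α * q` within the
  -- moment assumption on downward jumps.
  obtain ⟨q, hq, hqβ⟩ := exists_between (max_lt hp.2 ((one_lt_div hα0).2 hβ))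
  have hpq : p ≤ q := (le_max_left _ _).trans hq.le
  have hq1 : 1 < q := (le_max_right _ _).trans_lt hq
  have hγβ : α * q ≤ β := by
    rw [mul_comm]; exact ((lt_div_iff₀ hα0).1 hqβ).le
  have hαγ : α < α * q := lt_mul_of_one_lt_right hα0 hq1
  obtain ⟨K, hK, hgrow⟩ := exists_add_rpow_le (hα0.trans hαγ) hγβ
  obtain ⟨ε, A, hε, hA, hthr⟩ := exists_threshold_drift (C := C) (K := K) (x₀ := x₀) hα hαγ hc
  have he : 0 < ε / q := by positivity
  -- The shift `y = x + A` forces `y - X t ω ≥ A` whenever `X t ω < x`.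
  refine lintegral_rpow_lt_top_of_le hp.1 hpq
    (lintegral_firstPassageTime_rpow_lt_top_of_supermartingale (α := α) (y := x + A) hX hX0
      (by linarith) he fun t => ?_)
  refine setLIntegral_lyapunov_succ_le hX hα0 hq1.le hK hc hε hA hgrow hthr (hneg t)
    (fun x hx => hpos x hx t) (by positivity) (measurableSet_lt_firstPassageTime hX x t)
    fun ω hω => ?_
  have := lt_firstPassageTime_iff.1 hω t le_rfl
  linarith
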